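/- Let $K$ be a scattered compact Hausdorff space (scattered: every nonempty subset $A$ of $K$ has a point isolated in $A$) of finite height, that is, some $n$-th Cantor–Bendixson derivative $K^{(n)}$ with $n\in\mathbb N$ is empty, and suppose that the cardinality of $K$ is at least $\mathrm{cf}(\mathfrak c)$, the cofinality of the cardinality $\mathfrak c$ of the continuum. Then $\mathrm{Ext}(C(K),c_0)\neq 0$: there exist a real Banach space $X$ and bounded linear maps $j,q$ forming a short exact sequence $0\to c_0\xrightarrow{\,j\,} X\xrightarrow{\,q\,} C(K)\to 0$ which does not split, i.e. there is no bounded linear $r:X\to c_0$ with $r\circ j=\mathrm{id}_{c_0}$. Here $C(K)$ is the Banach space of real-valued continuous functions on $K$ with the supremum norm, and $c_0$ is the Banach space of real sequences converging to $0$ with the supremum norm. -/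

import Mathlib

open Set Ordinal Cardinal
open scoped ZeroAtInfty

universe u v

/-- A topological space is scattered if no nonempty subset is dense-in-itself
(`Preperfect A`: every point of `A` is an accumulation point of `A`). -/
def IsScatteredSpace (X : Type u) [TopologicalSpace X] : Prop :=
  ∀ A : Set X, A.Nonempty → ¬ Preperfect A

/-- The `α`-th Cantor-Bendixson derivative of the space `X`. -/
def cantorBendixsonDerivative (X : Type u) [TopologicalSpace X] (α : Ordinal.{u}) : Set X :=
  CantorBendixson.iteratedDerivedSet (Set.univ : Set X) α

/-- The scattered height of a scattered space, i.e. the least ordinal `α` whose Cantor-Bendixson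
derivative is empty. For a scattered space such ordinals exist, see
`exists_cantorBendixsonDerivative_eq_empty`. -/
noncomputable def scatteredHeight (X : Type u) [TopologicalSpace X] : Ordinal.{u} :=
  sInf {α : Ordinal.{u} | cantorBendixsonDerivative X α = ∅}

/-- Some Cantor-Bendixson derivative of a scattered space is empty, so that the infimum defining
the scattered height is a minimum. -/
theorem exists_cantorBendixsonDerivative_eq_empty {X : Type u} [TopologicalSpace X]
    (hX : IsScatteredSpace X) : ∃ α : Ordinal.{u}, cantorBendixsonDerivative X α = ∅ := by
  obtain ⟨α, hα⟩ := CantorBendixson.iteratedDerivedSet_mem_fixedPoints (Set.univ : Set X)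
  refine ⟨α, ?_⟩
  by_contra hne
  refine hX _ (Set.nonempty_iff_ne_empty.mpr hne) ?_
  exact preperfect_iff_eq_relDerivedSet.mpr hα.symm

/-- The bounded linear maps `j : Y → X` and `q : X → Z` form a short exact sequence
`0 → Y → X → Z → 0`, i.e. `X` is a twisted sum of `Y` and `Z`. -/
structure IsTwistedSum {Y X Z : Type*}
    [NormedAddCommGroup Y] [NormedSpace ℝ Y] [NormedAddCommGroup X] [NormedSpace ℝ X]
    [NormedAddCommGroup Z] [NormedSpace ℝ Z]
    (j : Y →L[ℝ] X) (q : X →L[ℝ] Z) : Prop where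
  injective : Function.Injective j
  exact : Function.Exact j q
  surjective : Function.Surjective q

/-- `Ext(Z, Y) = 0`: every twisted sum `0 → Y → X → Z → 0` with `X` a real Banach space is
trivial, i.e. the map `Y → X` has a bounded linear left inverse. Every twisted sum of `Y` and `Z`
has the cardinality of `Y × Z`, so no generality is lost by the universe in which `X` lives. -/
def ExtEqZero (Z : Type u) (Y : Type v) [NormedAddCommGroup Z] [NormedSpace ℝ Z]
    [NormedAddCommGroup Y] [NormedSpace ℝ Y] : Prop :=
  ∀ (X : Type (max u v)) [NormedAddCommGroup X] [NormedSpace ℝ X] [CompleteSpace X]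
    (j : Y →L[ℝ] X) (q : X →L[ℝ] Z), IsTwistedSum j q →
      ∃ r : X →L[ℝ] Y, r.comp j = ContinuousLinearMap.id ℝ Y

/-- A decreasing sequence of closed sets, from the whole space down to the empty set, in which
every set is discrete outside the next one. -/
structure IsDiscreteFiltration {K : Type u} [TopologicalSpace K] (D : ℕ → Set K) (N : ℕ) :
    Prop where
  zero : D 0 = Set.univ
  last : D N = ∅
  isClosed : ∀ i, IsClosed (D i)
  succ_subset : ∀ i, D (i + 1) ⊆ D i
  isolated : ∀ i, ∀ x ∈ D i, x ∉ D (i + 1) → ∃ U, IsOpen U ∧ U ∩ D i = {x}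

theorem exists_isDiscreteFiltration {K : Type u} [TopologicalSpace K] [T1Space K]
    (hscattered : IsScatteredSpace K) (hheight : scatteredHeight K < ω) :
    ∃ (D : ℕ → Set K) (N : ℕ), IsDiscreteFiltration D N := by
  obtain ⟨N, hN⟩ := Ordinal.lt_omega0.1 hheight
  have hmem : cantorBendixsonDerivative K (scatteredHeight K) = ∅ :=
    csInf_mem (s := {α : Ordinal.{u} | cantorBendixsonDerivative K α = ∅})
      (exists_cantorBendixsonDerivative_eq_empty hscattered)
  have hsucc (i : ℕ) : cantorBendixsonDerivative K ((i + 1 : ℕ) : Ordinal) =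
      relDerivedSet (cantorBendixsonDerivative K (i : Ordinal)) := by
    rw [cantorBendixsonDerivative, Nat.cast_add, Nat.cast_one,
      CantorBendixson.iteratedDerivedSet_succ, cantorBendixsonDerivative]
  refine ⟨fun i ↦ cantorBendixsonDerivative K (i : Ordinal), N, ?_, ?_, ?_, ?_, ?_⟩
  · simp [cantorBendixsonDerivative, CantorBendixson.iteratedDerivedSet_zero]
  · rw [← hN, hmem]
  · exact fun i ↦ CantorBendixson.isClosed_iteratedDerivedSet isClosed_univ _
  · intro i
    simp only [hsucc]
    exact relDerivedSet_subset
  · intro i x hx hx'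
    simp only [hsucc, relDerivedSet_apply, mem_inter_iff, hx, and_true, mem_derivedSet,
      accPt_iff_nhds, not_forall, not_exists, not_and, not_not] at hx'
    obtain ⟨U, hU, h⟩ := hx'
    obtain ⟨V, hVU, hV, hxV⟩ := mem_nhds_iff.1 hU
    refine ⟨V, hV, Subset.antisymm (fun y hy ↦ h y ⟨hVU hy.1, hy.2⟩) ?_⟩
    rintro y rfl
    exact ⟨hxV, hx⟩

namespace IsDiscreteFiltration

variable {K : Type u} [TopologicalSpace K] {D : ℕ → Set K} {N : ℕ}

theorem finite_inter (hD : IsDiscreteFiltration D N) [CompactSpace K] {C : Set K}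
    (hC : IsClosed C) {i : ℕ} (h : Disjoint C (D (i + 1))) : (C ∩ D i).Finite := by
  have hcomp : IsCompact (C ∩ D i) := (hC.inter (hD.isClosed i)).isCompact
  by_contra hinf
  obtain ⟨x, hx, hacc⟩ := Set.Infinite.exists_accPt_of_subset_isCompact hinf hcomp subset_rfl
  obtain ⟨U, hU, hUx⟩ := hD.isolated i x hx.2 (disjoint_left.1 h hx.1)
  have hxU : x ∈ U := (hUx.ge rfl).1
  obtain ⟨y, hy, hne⟩ := accPt_iff_nhds.1 hacc U (hU.mem_nhds hxU)
  exact hne (hUx.le ⟨hy.1, hy.2.2⟩)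

theorem exists_bump (hD : IsDiscreteFiltration D N) [CompactSpace K] [T2Space K] {i : ℕ} {x : K}
    (hx : x ∈ D i) (hx' : x ∉ D (i + 1)) :
    ∃ e : C(K, ℝ), e x = 1 ∧ (∀ y ∈ D i, y ≠ x → e y = 0) := by
  obtain ⟨U, hU, hUx⟩ := hD.isolated i x hx hx'
  have hcl : IsClosed (D i \ {x}) := by
    have : D i \ {x} = D i \ U := by
      rw [← hUx]; ext y; simp +contextual
    rw [this]
    exact (hD.isClosed i).sdiff hU
  obtain ⟨e, h0, h1, -⟩ := exists_continuous_zero_one_of_isClosed hcl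
    (isClosed_singleton (x := x)) disjoint_sdiff_left
  exact ⟨e, h1 rfl, fun y hy hne ↦ h0 ⟨hy, hne⟩⟩

end IsDiscreteFiltration

theorem abs_apply_le_of_eqOn_zero {K : Type u} [TopologicalSpace K] [CompactSpace K] {A : Set K}
    (φ : C(K, ℝ) →L[ℝ] ℝ) (hφ : ∀ f : C(K, ℝ), (∀ x ∈ A, f x = 0) → φ f = 0)
    {r : ℝ} (hr : 0 ≤ r) {f : C(K, ℝ)} (hf : ∀ x ∈ A, |f x| ≤ r) : |φ f| ≤ ‖φ‖ * r := by
  let g : C(K, ℝ) := ⟨fun x ↦ max (-r) (min r (f x)), by fun_prop⟩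
  have hg : φ f = φ g := by
    rw [← sub_eq_zero, ← map_sub]
    refine hφ _ fun x hx ↦ ?_
    have := abs_le.1 (hf x hx)
    simp [g, min_eq_right this.2, max_eq_right this.1]
  rw [hg, ← Real.norm_eq_abs]
  refine (φ.le_opNorm g).trans (mul_le_mul_of_nonneg_left ?_ (norm_nonneg _))
  refine (ContinuousMap.norm_le _ hr).2 fun x ↦ ?_
  rw [Real.norm_eq_abs, abs_le]
  exact ⟨le_max_left _ _, max_le (by linarith) (min_le_left _ _)⟩

theorem exists_clm_hasSum {K : Type u} [TopologicalSpace K] [CompactSpace K] {a : K → ℝ}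
    (ha : Summable a) :
    ∃ ψ : C(K, ℝ) →L[ℝ] ℝ, ∀ f : C(K, ℝ), HasSum (fun x ↦ a x * f x) (ψ f) := by
  have hs (f : C(K, ℝ)) : Summable fun x ↦ a x * f x := by
    refine Summable.of_norm_bounded (ha.abs.mul_right ‖f‖) fun x ↦ ?_
    rw [norm_mul, Real.norm_eq_abs]
    exact mul_le_mul_of_nonneg_left (f.norm_coe_le_norm x) (abs_nonneg _)
  refine ⟨LinearMap.mkContinuous
    { toFun f := ∑' x, a x * f x
      map_add' f g := by simp only [ContinuousMap.add_apply, mul_add, (hs f).tsum_add (hs g)]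
      map_smul' r f := by
        simp only [ContinuousMap.smul_apply, _root_.smul_eq_mul, mul_left_comm _ r, tsum_mul_left,
          RingHom.id_apply] } (∑' x, |a x|) fun f ↦ ?_, fun f ↦ (hs f).hasSum⟩
  rw [← tsum_mul_right]
  refine tsum_of_norm_bounded (ha.abs.mul_right ‖f‖).hasSum fun x ↦ ?_
  rw [norm_mul, Real.norm_eq_abs]
  exact mul_le_mul_of_nonneg_left (f.norm_coe_le_norm x) (abs_nonneg _)

namespace IsDiscreteFiltration

variable {K : Type u} [TopologicalSpace K] [CompactSpace K] [T2Space K] {D : ℕ → Set K} {N : ℕ}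

/-- A functional vanishing on the functions which are zero on `D i` agrees, on the functions which
are zero on `D (i + 1)`, with a summable combination of point evaluations. -/
theorem exists_hasSum_of_eqOn_zero_succ (hD : IsDiscreteFiltration D N) (i : ℕ)
    (φ : C(K, ℝ) →L[ℝ] ℝ) (hφ : ∀ f : C(K, ℝ), (∀ x ∈ D i, f x = 0) → φ f = 0) :
    ∃ a : K → ℝ, Summable a ∧ ∀ f : C(K, ℝ), (∀ x ∈ D (i + 1), f x = 0) →
      HasSum (fun x ↦ a x * f x) (φ f) := by
  classical
  have hbump (x : K) : ∃ e : C(K, ℝ), (x ∈ D i → x ∉ D (i + 1) → e x = 1) ∧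
      (x ∈ D i → x ∈ D (i + 1) → e x = 0) ∧ ∀ y ∈ D i, y ≠ x → e y = 0 := by
    by_cases hx : x ∈ D i ∧ x ∉ D (i + 1)
    · obtain ⟨e, h1, h2⟩ := hD.exists_bump hx.1 hx.2
      exact ⟨e, fun _ _ ↦ h1, fun _ h ↦ absurd h hx.2, h2⟩
    · exact ⟨0, fun h h' ↦ absurd ⟨h, h'⟩ hx, fun _ _ ↦ rfl, fun _ _ _ ↦ rfl⟩
  choose e he1 he0 he using hbump
  have hsum (F : Finset K) (c : K → ℝ) (y : K) (hy : y ∈ D i) :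
      (∑ x ∈ F, c x • e x) y = if y ∈ F then c y * e y y else 0 := by
    rw [ContinuousMap.sum_apply]
    split_ifs with h
    · rw [Finset.sum_eq_single y]
      · simp
      · intro x _ hxy
        simp [he x y hy hxy.symm]
      · exact fun h' ↦ absurd h h'
    · refine Finset.sum_eq_zero fun x hx ↦ ?_
      have : y ≠ x := by rintro rfl; exact h hx
      simp [he x y hy this]
  have hself (y : K) (hy : y ∈ D i) : |e y y| ≤ 1 := by
    by_cases h : y ∈ D (i + 1)
    · simp [he0 y hy h]
    · simp [he1 y hy h]
  refine ⟨fun x ↦ φ (e x), ?_, fun f hf ↦ ?_⟩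
  · refine Summable.of_abs (summable_of_sum_le (c := ‖φ‖ * 1) (fun _ ↦ abs_nonneg _) fun F ↦ ?_)
    have : ∑ x ∈ F, |φ (e x)| = φ (∑ x ∈ F, (SignType.sign (φ (e x)) : ℝ) • e x) := by
      simp only [map_sum, map_smul, _root_.smul_eq_mul, sign_mul_self]
    rw [this]
    refine (le_abs_self _).trans (abs_apply_le_of_eqOn_zero φ hφ zero_le_one fun y hy ↦ ?_)
    rw [hsum F _ y hy]
    split_ifs
    · rw [abs_mul]
      refine mul_le_one₀ ?_ (abs_nonneg _) (hself y hy)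
      rcases SignType.sign (φ (e y)) with _ | _ | _ <;> simp
    · simp
  · rw [HasSum, Metric.tendsto_nhds]
    intro ε hε
    set δ : ℝ := ε / (‖φ‖ + 1) with hδ
    have hφ0 : 0 < ‖φ‖ + 1 := by positivity
    have hδ0 : 0 < δ := by positivity
    have hfin : ({x | δ ≤ |f x|} ∩ D i).Finite := by
      refine hD.finite_inter (isClosed_le continuous_const (by fun_prop))
        (disjoint_left.2 fun x hx hx' ↦ ?_)
      simp only [mem_ofPred_eq, hf x hx', abs_zero] at hx
      linarith
    filter_upwards [Filter.eventually_ge_atTop hfin.toFinset] with F hF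
    have hg : ∀ y ∈ D i, |(f - ∑ x ∈ F, f x • e x) y| ≤ δ := by
      intro y hy
      rw [ContinuousMap.sub_apply, hsum F _ y hy]
      split_ifs with h
      · by_cases h' : y ∈ D (i + 1)
        · simp [hf y h', hδ0.le]
        · simp [he1 y hy h', hδ0.le]
      · by_contra! hlt
        exact h (hF (hfin.mem_toFinset.2 ⟨by simpa using hlt.le, hy⟩))
    have := abs_apply_le_of_eqOn_zero φ hφ hδ0.le hg
    rw [map_sub, map_sum] at this
    simp only [map_smul, _root_.smul_eq_mul] at this
    rw [dist_comm, Real.dist_eq]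
    simp only [mul_comm (φ _)]
    refine this.trans_lt ?_
    rw [hδ, ← mul_div_assoc, div_lt_iff₀ hφ0]
    nlinarith

/-- Every functional on `C(K)` is a summable combination of point evaluations. -/
theorem exists_hasSum (hD : IsDiscreteFiltration D N) (φ : C(K, ℝ) →L[ℝ] ℝ) :
    ∃ a : K → ℝ, Summable a ∧ ∀ f : C(K, ℝ), HasSum (fun x ↦ a x * f x) (φ f) := by
  suffices H : ∀ k i, i + k = N → ∀ φ : C(K, ℝ) →L[ℝ] ℝ,
      (∀ f : C(K, ℝ), (∀ x ∈ D i, f x = 0) → φ f = 0) →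
      ∃ a : K → ℝ, Summable a ∧ ∀ f : C(K, ℝ), HasSum (fun x ↦ a x * f x) (φ f) by
    refine H N 0 (zero_add N) φ fun f hf ↦ ?_
    have : f = 0 := by ext x; exact hf x (by simp [hD.zero])
    rw [this, map_zero]
  intro k
  induction k with
  | zero =>
    rintro i rfl φ hφ
    have h0 (f : C(K, ℝ)) : φ f = 0 := hφ f fun x hx ↦ (hD.last.subset hx).elim
    exact ⟨0, summable_zero, fun f ↦ by simp [h0, hasSum_zero]⟩
  | succ k ih =>
    intro i hi φ hφ
    obtain ⟨a, ha, haf⟩ := hD.exists_hasSum_of_eqOn_zero_succ i φ hφ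
    obtain ⟨ψ, hψf⟩ := exists_clm_hasSum ha
    obtain ⟨b, hb, hbf⟩ := ih (i + 1) (by omega) (φ - ψ) fun f hf ↦ by
      rw [_root_.sub_apply, sub_eq_zero]
      exact (haf f hf).unique (hψf f)
    refine ⟨a + b, ha.add hb, fun f ↦ ?_⟩
    have := (hψf f).add (hbf f)
    simpa [add_mul] using this

end IsDiscreteFiltration

namespace IsDiscreteFiltration

variable {K : Type u} [TopologicalSpace K] [CompactSpace K] {D : ℕ → Set K} {N : ℕ}

/-- Infinitely many continuous functions take at most as many values jointly as there are
functions. -/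
theorem mk_range_eval_le (hD : IsDiscreteFiltration D N) {ι : Type u} [Infinite ι]
    (f : ι → C(K, ℝ)) : #(range fun x i ↦ f i x) ≤ #ι := by
  classical
  have hι : ℵ₀ ≤ #ι := aleph0_le_mk ι
  let C (c : ι × ℚ × ℚ) : Set K := f c.1 ⁻¹' Icc (c.2.1 : ℝ) c.2.2
  have hC (c) : IsClosed (C c) := isClosed_Icc.preimage (f c.1).continuous
  have hsep (x y : K) (h : (fun i ↦ f i x) ≠ fun i ↦ f i y) : ∃ c, x ∈ C c ∧ y ∉ C c := by
    obtain ⟨i, hi⟩ := Function.ne_iff.1 h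
    rcases lt_or_gt_of_ne hi with hlt | hlt
    · obtain ⟨q, hq⟩ := exists_rat_lt (f i x)
      obtain ⟨r, hr, hr'⟩ := exists_rat_btwn hlt
      exact ⟨(i, q, r), ⟨hq.le, hr.le⟩, fun h ↦ h.2.not_gt hr'⟩
    · obtain ⟨q, hq⟩ := exists_rat_gt (f i x)
      obtain ⟨r, hr, hr'⟩ := exists_rat_btwn hlt
      exact ⟨(i, r, q), ⟨hr'.le, hq.le⟩, fun h ↦ h.1.not_gt hr⟩
  have hcode : #(Finset (ι × ℚ × ℚ)) = #ι := by
    rw [mk_finset_of_infinite]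
    simp [hι]
  suffices H : ∀ k i, i + k = N → #((fun x i ↦ f i x) '' D i) ≤ #ι by
    have := H N 0 (zero_add N)
    rwa [hD.zero, image_univ] at this
  intro k
  induction k with
  | zero =>
    intro i hi
    have : D i = ∅ := by rw [← hD.last, ← hi, add_zero]
    simp [this]
  | succ k ih =>
    intro i hi
    set t : K → ι → ℝ := fun x i ↦ f i x
    let E : Set K := ⋃ G : {G : Finset (ι × ℚ × ℚ) // Disjoint (⋂ c ∈ G, C c) (D (i + 1))},
      ((⋂ c ∈ G.1, C c) ∩ D i)
    have hE : #E ≤ #ι := by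
      refine (mk_iUnion_le _).trans ?_
      refine (mul_le_mul' ((mk_subtype_le _).trans hcode.le) (ciSup_le' fun G ↦ ?_)).trans
        (mul_aleph0_eq hι).le
      exact (hD.finite_inter (isClosed_biInter fun c _ ↦ hC c) G.2).countable.le_aleph0
    have hsub : t '' D i ⊆ t '' D (i + 1) ∪ t '' E := by
      rintro _ ⟨x, hx, rfl⟩
      by_cases hxt : t x ∈ t '' D (i + 1)
      · exact Or.inl hxt
      refine Or.inr ⟨x, ?_, rfl⟩
      obtain ⟨G, hG⟩ := (hD.isClosed (i + 1)).isCompact.elim_finite_subfamily_closed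
        (fun c : {c // x ∈ C c} ↦ C c) (fun c ↦ hC c) (by
          refine eq_empty_of_forall_notMem fun y hy ↦ ?_
          obtain ⟨c, hxc, hyc⟩ := hsep x y fun h ↦ hxt ⟨y, hy.1, h.symm⟩
          exact hyc (mem_iInter.1 hy.2 ⟨c, hxc⟩))
      refine mem_iUnion.2 ⟨⟨G.image Subtype.val, ?_⟩, ?_, hx⟩
      · rw [disjoint_iff_inter_eq_empty, inter_comm, ← hG,
          Finset.set_biInter_finset_image]
      · simp +contextual
    calc #(t '' D i) ≤ #(t '' D (i + 1)) + #(t '' E) :=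
          (mk_le_mk_of_subset hsub).trans (mk_union_le _ _)
      _ ≤ #ι + #ι := add_le_add (ih (i + 1) (by omega)) (mk_image_le.trans hE)
      _ = #ι := add_eq_self hι

end IsDiscreteFiltration

theorem exists_le_mk_nhds_inter {K : Type u} [TopologicalSpace K] [CompactSpace K]
    {κ : Cardinal.{u}} (hκ : ℵ₀ ≤ κ) {A : Set K} (hA : κ ≤ #A) :
    ∃ x, ∀ U ∈ nhds x, κ ≤ #(U ∩ A : Set K) := by
  by_contra! h
  choose U hU hUA using h
  obtain ⟨t, ht⟩ := CompactSpace.elim_nhds_subcover U hU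
  have key (s : Finset K) : #((⋃ x ∈ s, U x) ∩ A : Set K) < κ := by
    classical
    induction s using Finset.induction_on with
    | empty => simpa using aleph0_pos.trans_le hκ
    | insert x s _ ih =>
      rw [Finset.set_biUnion_insert, union_inter_distrib_right]
      exact (mk_union_le _ _).trans_lt (add_lt_of_lt hκ (hUA x) ih)
  refine (key t).not_ge ?_
  rwa [ht, top_eq_univ, univ_inter]

namespace IsDiscreteFiltration

variable {K : Type u} [TopologicalSpace K] [CompactSpace K] [T2Space K] {D : ℕ → Set K} {N : ℕ}

/-- A large scattered space of finite height contains a large set of isolated points of one of its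
derivatives which converges to a single point. -/
theorem exists_convergent_set (hD : IsDiscreteFiltration D N) (hK : IsScatteredSpace K)
    {κ : Cardinal.{u}} (hκ : κ.IsRegular) (hcard : κ ≤ #K) :
    ∃ (i : ℕ) (p : K) (S : Set K), #S = κ ∧ p ∈ D i ∧ p ∉ S ∧ S ⊆ D i \ D (i + 1) ∧
      ∀ (f : C(K, ℝ)) (ε : ℝ), 0 < ε → {s ∈ S | ε ≤ |f s - f p|}.Finite := by
  classical
  have hκ0 := hκ.aleph0_le
  obtain ⟨i, hi, hi'⟩ : ∃ i, κ ≤ #(D i) ∧ #(D (i + 1)) < κ := by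
    have hex : ∃ i, #(D i) < κ := ⟨N, by simpa [hD.last] using hκ.pos⟩
    have h0 : Nat.find hex ≠ 0 := fun h ↦ by
      have := Nat.find_spec hex
      rw [h, hD.zero, mk_univ] at this
      exact this.not_ge hcard
    obtain ⟨i, hi⟩ := Nat.exists_eq_succ_of_ne_zero h0
    exact ⟨i, not_lt.1 (Nat.find_min hex (by omega)), by
      have := Nat.find_spec hex
      rwa [hi] at this⟩
  set Γ : Set K := D i \ D (i + 1) with hΓ
  have hΓc : κ ≤ #Γ := by
    by_contra! hlt
    refine (((mk_le_mk_of_subset ?_).trans (mk_union_le Γ (D (i + 1)))).trans_lt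
      (add_lt_of_lt hκ0 hlt hi')).not_ge hi
    exact fun x hx ↦ (em (x ∈ D (i + 1))).elim Or.inr fun h ↦ Or.inl ⟨hx, h⟩
  set P : Set K := {x | ∀ U ∈ nhds x, κ ≤ #(U ∩ Γ : Set K)} with hP
  have hPne : P.Nonempty := exists_le_mk_nhds_inter hκ0 hΓc
  have hPD : P ⊆ D i := by
    intro x hx
    by_contra hxD
    have h := hx _ ((hD.isClosed i).isOpen_compl.mem_nhds hxD)
    have : (D i)ᶜ ∩ Γ = ∅ := by
      ext y; simp [hΓ]; tauto
    rw [this, mk_eq_zero] at h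
    exact hκ.pos.not_ge h
  obtain ⟨p, hp, hacc⟩ : ∃ p ∈ P, ¬ AccPt p (Filter.principal P) := by
    have := hK P hPne
    simpa [Preperfect] using this
  obtain ⟨V, hV, hVP⟩ : ∃ V ∈ nhds p, ∀ q ∈ V, q ∈ P → q = p := by
    simpa [accPt_iff_nhds] using hacc
  obtain ⟨W, hW, hWc, hWV⟩ := exists_mem_nhds_isClosed_subset hV
  have hsmall (q : K) (hq : q ∉ P) : ∃ U, IsOpen U ∧ q ∈ U ∧ #(U ∩ Γ : Set K) < κ := by
    simp only [hP, mem_ofPred_eq, not_forall, not_le] at hq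
    obtain ⟨U, hU, hlt⟩ := hq
    obtain ⟨O, hOU, hO, hqO⟩ := mem_nhds_iff.1 hU
    exact ⟨O, hO, hqO, (mk_le_mk_of_subset (inter_subset_inter_left _ hOU)).trans_lt hlt⟩
  choose! U hUo hqU hUc using hsmall
  set Q : Set K := (D (i + 1) ∩ W) \ {p} with hQ
  have hQP : ∀ q ∈ Q, q ∉ P := fun q hq hqP ↦ hq.2 (hVP q (hWV hq.1.2) hqP)
  set R : Set K := (⋃ q ∈ Q, U q ∩ Γ) ∪ {p} with hR
  have hRc : #R < κ := by
    refine (mk_union_le _ _).trans_lt (add_lt_of_lt hκ0 ?_ ?_)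
    · refine (card_biUnion_lt_iff_forall_of_isRegular hκ ?_).2 fun q hq ↦ hUc q (hQP q hq)
      exact (mk_le_mk_of_subset (sdiff_subset.trans inter_subset_left)).trans_lt hi'
    · rw [mk_singleton]
      exact one_lt_aleph0.trans_le hκ0
  have hlarge : κ ≤ #((W ∩ Γ) \ R : Set K) := by
    by_contra! hlt
    refine (((mk_le_mk_of_subset ?_).trans (mk_union_le ((W ∩ Γ) \ R) R)).trans_lt
      (add_lt_of_lt hκ0 hlt hRc)).not_ge (hp W hW)
    exact fun x hx ↦ (em (x ∈ R)).elim Or.inr fun h ↦ Or.inl ⟨hx, h⟩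
  obtain ⟨S, hSsub, hS⟩ := le_mk_iff_exists_subset.1 hlarge
  refine ⟨i, p, S, hS, hPD hp, fun h ↦ (hSsub h).2 (Or.inr rfl), fun s hs ↦ (hSsub hs).1.2,
    fun f ε hε ↦ ?_⟩
  by_contra hinf
  have hcl : IsClosed (W ∩ D i ∩ {x | ε ≤ |f x - f p|}) :=
    (hWc.inter (hD.isClosed i)).inter (isClosed_le continuous_const (by fun_prop))
  obtain ⟨q, ⟨⟨hqW, hqD⟩, hqf⟩, hq⟩ := Set.Infinite.exists_accPt_of_subset_isCompact hinf
    hcl.isCompact fun s hs ↦ ⟨⟨(hSsub hs.1).1.1, (hSsub hs.1).1.2.1⟩, hs.2⟩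
  have hqp : q ≠ p := by
    rintro rfl
    have : ε ≤ |f q - f q| := hqf
    rw [_root_.sub_self, abs_zero] at this
    exact this.not_gt hε
  by_cases hqD' : q ∈ D (i + 1)
  · have hqQ : q ∈ Q := ⟨⟨hqD', hqW⟩, hqp⟩
    obtain ⟨y, hy, -⟩ := accPt_iff_nhds.1 hq (U q)
      ((hUo q (hQP q hqQ)).mem_nhds (hqU q (hQP q hqQ)))
    exact (hSsub hy.2.1).2 (Or.inl (mem_biUnion hqQ ⟨hy.1, (hSsub hy.2.1).1.2⟩))
  · obtain ⟨O, hO, hOq⟩ := hD.isolated i q hqD hqD'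
    obtain ⟨y, hy, hne⟩ := accPt_iff_nhds.1 hq O (hO.mem_nhds (hOq.ge rfl).1)
    exact hne (hOq.le ⟨hy.1, (hSsub hy.2.1).1.2.1⟩)

end IsDiscreteFiltration

/-- A bounded functional vanishing on the kernel of a surjection of Banach spaces factors through
the surjection. -/
theorem exists_clm_comp_eq {X Z : Type*} [NormedAddCommGroup X] [NormedSpace ℝ X] [CompleteSpace X]
    [NormedAddCommGroup Z] [NormedSpace ℝ Z] [CompleteSpace Z] (q : X →L[ℝ] Z)
    (hq : Function.Surjective q) (ψ : X →L[ℝ] ℝ) (hψ : ∀ x, q x = 0 → ψ x = 0) :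
    ∃ φ : Z →L[ℝ] ℝ, ∀ x, φ (q x) = ψ x := by
  obtain ⟨σ, -⟩ := q.exists_nonlinearRightInverse_of_surjective (LinearMap.range_eq_top.2 hq)
  have key (x y : X) (h : q x = q y) : ψ x = ψ y := by
    rw [← sub_eq_zero, ← map_sub]
    exact hψ _ (by rw [map_sub, h, _root_.sub_self])
  refine ⟨LinearMap.mkContinuous
    { toFun z := ψ (σ z)
      map_add' z w := by
        rw [← map_add]
        exact key _ _ (by simp only [map_add, σ.right_inv])
      map_smul' c z := by
        rw [← map_smul]
        exact key _ _ (by simp only [map_smul, σ.right_inv, RingHom.id_apply]) }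
    (‖ψ‖ * σ.nnnorm) fun z ↦ ?_, fun x ↦ key _ _ (σ.right_inv _)⟩
  refine (ψ.le_opNorm _).trans ?_
  rw [mul_assoc]
  exact mul_le_mul_of_nonneg_left (σ.bound z) (norm_nonneg _)

theorem exists_clm_comp_eq_sub {X Z : Type*} [NormedAddCommGroup X] [NormedSpace ℝ X]
    [CompleteSpace X] [NormedAddCommGroup Z] [NormedSpace ℝ Z] [CompleteSpace Z] (q : X →L[ℝ] Z)
    (hq : Function.Surjective q) (ψ ψ' : X →L[ℝ] ℝ) (hψ : ∀ x, q x = 0 → ψ x = ψ' x) :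
    ∃ φ : Z →L[ℝ] ℝ, ∀ x, φ (q x) = ψ x - ψ' x :=
  exists_clm_comp_eq q hq (ψ - ψ') fun x hx ↦ sub_eq_zero.2 (hψ x hx)

section TwistedSum

variable {Z : Type u} [NormedAddCommGroup Z] [NormedSpace ℝ Z] {ι : Type v}

/-- The pairs `(z, y)` for which the bounded sequence `y` represents the element
`∑ i, g i z • 1_{C i}` of `ℓ∞ / c₀`. -/
def pullbackSubmodule (g : ι → Z →L[ℝ] ℝ) (C : ι → Set ℕ) :
    Submodule ℝ (Z × BoundedContinuousFunction ℕ ℝ) where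
  carrier := {x | (∀ i, ∀ ε > 0, ∀ᶠ n in Filter.atTop, n ∈ C i → |x.2 n - g i x.1| ≤ ε) ∧
    ∀ ε > 0, ∃ F : Finset ι, ∀ᶠ n in Filter.atTop, (∀ i ∈ F, n ∉ C i) → |x.2 n| ≤ ε}
  zero_mem' := by
    refine ⟨fun i ε hε ↦ ?_, fun ε hε ↦ ⟨∅, ?_⟩⟩ <;> simp [hε.le]
  add_mem' := by
    classical
    rintro ⟨z, y⟩ ⟨z', y'⟩ ⟨h1, h2⟩ ⟨h1', h2'⟩
    refine ⟨fun i ε hε ↦ ?_, fun ε hε ↦ ?_⟩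
    · filter_upwards [h1 i (ε / 2) (half_pos hε), h1' i (ε / 2) (half_pos hε)] with n h h' hn
      have := h hn
      have := h' hn
      simp only [Prod.mk_add_mk, BoundedContinuousFunction.add_apply, map_add]
      rw [abs_le] at *
      constructor <;> linarith
    · obtain ⟨F, hF⟩ := h2 (ε / 2) (half_pos hε)
      obtain ⟨F', hF'⟩ := h2' (ε / 2) (half_pos hε)
      refine ⟨F ∪ F', ?_⟩
      filter_upwards [hF, hF'] with n h h' hn
      have := h fun i hi ↦ hn i (Finset.mem_union_left _ hi)
      have := h' fun i hi ↦ hn i (Finset.mem_union_right _ hi)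
      simp only [Prod.mk_add_mk, BoundedContinuousFunction.add_apply]
      rw [abs_le] at *
      constructor <;> linarith
  smul_mem' := by
    rintro c ⟨z, y⟩ ⟨h1, h2⟩
    have hc : 0 < |c| + 1 := by positivity
    have key {ε r : ℝ} (hε : 0 < ε) (hr : |r| ≤ ε / (|c| + 1)) : |c * r| ≤ ε := by
      rw [le_div_iff₀ hc] at hr
      rw [abs_mul]
      nlinarith [abs_nonneg r]
    refine ⟨fun i ε hε ↦ ?_, fun ε hε ↦ ?_⟩
    · filter_upwards [h1 i (ε / (|c| + 1)) (by positivity)] with n h hn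
      have := key hε (h hn)
      simpa only [_root_.mul_sub, Prod.smul_mk, BoundedContinuousFunction.coe_smul, map_smul,
        _root_.smul_eq_mul] using this
    · obtain ⟨F, hF⟩ := h2 (ε / (|c| + 1)) (by positivity)
      refine ⟨F, ?_⟩
      filter_upwards [hF] with n h hn
      have := key hε (h hn)
      simpa using this

theorem isClosed_pullbackSubmodule (g : ι → Z →L[ℝ] ℝ) (C : ι → Set ℕ) :
    IsClosed (pullbackSubmodule g C : Set (Z × BoundedContinuousFunction ℕ ℝ)) := by
  refine isClosed_of_closure_subset fun x hx ↦ ?_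
  rw [Metric.mem_closure_iff] at hx
  have hdist {δ : ℝ} {b : Z × BoundedContinuousFunction ℕ ℝ} (h : dist x b < δ) (n : ℕ) :
      |x.2 n - b.2 n| ≤ δ := by
    rw [← Real.dist_eq]
    exact (BoundedContinuousFunction.dist_coe_le_dist n).trans ((le_max_right _ _).trans h.le)
  refine ⟨fun i ε hε ↦ ?_, fun ε hε ↦ ?_⟩
  · obtain ⟨b, hb, hxb⟩ := hx (ε / 2 / (‖g i‖ + 1)) (by positivity)
    filter_upwards [hb.1 i (ε / 2) (half_pos hε)] with n h hn
    have h1 := hdist hxb n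
    have h2 : |g i x.1 - g i b.1| ≤ ‖g i‖ * (ε / 2 / (‖g i‖ + 1)) := by
      rw [← map_sub, ← Real.norm_eq_abs]
      refine ((g i).le_opNorm _).trans (mul_le_mul_of_nonneg_left ?_ (norm_nonneg _))
      rw [← dist_eq_norm]
      exact (le_max_left _ _).trans hxb.le
    have h3 : ‖g i‖ * (ε / 2 / (‖g i‖ + 1)) + ε / 2 / (‖g i‖ + 1) = ε / 2 := by
      field_simp
    have := h hn
    rw [abs_le] at *
    constructor <;> linarith
  · obtain ⟨b, hb, hxb⟩ := hx (ε / 2) (half_pos hε)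
    obtain ⟨F, hF⟩ := hb.2 (ε / 2) (half_pos hε)
    refine ⟨F, ?_⟩
    filter_upwards [hF] with n h hn
    have := hdist hxb n
    have := h hn
    rw [abs_le] at *
    constructor <;> linarith

variable {g : ι → Z →L[ℝ] ℝ} {C : ι → Set ℕ}

theorem exists_mem_pullbackSubmodule (hg : ∀ z, ∀ ε > 0, {i | ε ≤ |g i z|}.Finite)
    (hC : ∀ i j, i ≠ j → (C i ∩ C j).Finite) (z : Z) : ∃ y, (z, y) ∈ pullbackSubmodule g C := by
  classical
  have hmax (n : ℕ) : ∃ r : ℝ, (∀ i, n ∈ C i → |g i z| ≤ |r|) ∧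
      (r ≠ 0 → ∃ i, n ∈ C i ∧ g i z = r) := by
    by_cases h : ∃ i, n ∈ C i ∧ g i z ≠ 0
    · obtain ⟨i, hi, hi0⟩ := h
      obtain ⟨m, hm, hmax⟩ := ((hg z |g i z| (abs_pos.2 hi0)).subset
        (inter_subset_left (t := {k | n ∈ C k}))).exists_maximalFor (fun k ↦ |g k z|) _
        ⟨i, le_refl |g i z|, hi⟩
      refine ⟨g m z, fun k hk ↦ ?_, fun _ ↦ ⟨m, hm.2, rfl⟩⟩
      by_contra! hlt
      have hm1 : |g i z| ≤ |g m z| := hm.1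
      exact (hmax ⟨hm1.trans hlt.le, hk⟩ hlt.le).not_gt hlt
    · push Not at h
      exact ⟨0, fun i hi ↦ by simp [h i hi], fun h ↦ absurd rfl h⟩
  choose y hy hy0 using hmax
  obtain ⟨M, hM⟩ : ∃ M : ℝ, ∀ i, |g i z| ≤ M := by
    obtain ⟨M, hM⟩ := ((hg z 1 one_pos).image fun i ↦ |g i z|).bddAbove
    refine ⟨max M 1, fun i ↦ ?_⟩
    by_cases h : 1 ≤ |g i z|
    · exact (hM ⟨i, h, rfl⟩).trans (le_max_left _ _)
    · exact (not_le.1 h).le.trans (le_max_right _ _)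
  have hyM (n : ℕ) : ‖y n‖ ≤ max M 0 := by
    by_cases h : y n = 0
    · simp [h]
    · obtain ⟨i, -, hi⟩ := hy0 n h
      rw [← hi]
      exact (hM i).trans (le_max_left _ _)
  refine ⟨BoundedContinuousFunction.ofNormedAddCommGroup y continuous_of_discreteTopology _ hyM,
    fun i ε hε ↦ ?_, fun ε hε ↦ ⟨(hg z ε hε).toFinset, Filter.Eventually.of_forall fun n hn ↦ ?_⟩⟩
  · have hfin (δ : ℝ) (hδ : 0 < δ) : ∀ᶠ n in Filter.atTop, ∀ j, δ ≤ |g j z| → j ≠ i →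
        ¬ (n ∈ C i ∧ n ∈ C j) := by
      have : ({j | δ ≤ |g j z| ∧ j ≠ i}).Finite := (hg z δ hδ).subset fun j hj ↦ hj.1
      have := this.biUnion (t := fun j ↦ C i ∩ C j) fun j hj ↦ hC i j hj.2.symm
      rw [← Nat.cofinite_eq_atTop]
      filter_upwards [this.compl_mem_cofinite] with n hn j hj hji h
      exact hn (mem_biUnion (show j ∈ {j | δ ≤ |g j z| ∧ j ≠ i} from ⟨hj, hji⟩) h)
    by_cases h0 : g i z = 0
    · filter_upwards [hfin ε hε] with n hn hni
      simp only [BoundedContinuousFunction.coe_ofNormedAddCommGroup, h0, _root_.sub_zero]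
      by_contra! hlt
      have hyn : y n ≠ 0 := by
        intro h
        rw [h, abs_zero] at hlt
        exact hlt.not_gt hε
      obtain ⟨j, hj, hjy⟩ := hy0 n hyn
      refine hn j (by rw [hjy]; exact hlt.le) ?_ ⟨hni, hj⟩
      rintro rfl
      exact hyn (hjy ▸ h0)
    · filter_upwards [hfin _ (abs_pos.2 h0)] with n hn hni
      simp only [BoundedContinuousFunction.coe_ofNormedAddCommGroup]
      have hle := hy n i hni
      have hyn : y n ≠ 0 := abs_pos.1 ((abs_pos.2 h0).trans_le hle)
      obtain ⟨j, hj, hjy⟩ := hy0 n hyn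
      have : j = i := by
        by_contra hji
        exact hn j (by rwa [hjy]) hji ⟨hni, hj⟩
      rw [← hjy, this, _root_.sub_self, abs_zero]
      exact hε.le
  · simp only [BoundedContinuousFunction.coe_ofNormedAddCommGroup]
    by_contra! hlt
    have hyn : y n ≠ 0 := by
      intro h
      rw [h, abs_zero] at hlt
      exact hlt.not_gt hε
    obtain ⟨j, hj, hjy⟩ := hy0 n hyn
    exact hn j ((hg z ε hε).mem_toFinset.2 (by simpa [hjy] using hlt.le)) hj

theorem toBCF_mem_pullbackSubmodule (f : C₀(ℕ, ℝ)) : (0, f.toBCF) ∈ pullbackSubmodule g C := by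
  have h (ε : ℝ) (hε : 0 < ε) : ∀ᶠ n in Filter.atTop, |f n| ≤ ε := by
    have := f.zero_at_infty'
    rw [Filter.cocompact_eq_cofinite, Nat.cofinite_eq_atTop] at this
    have := this.abs
    rw [abs_zero] at this
    exact this.eventually_le_const hε
  refine ⟨fun i ε hε ↦ ?_, fun ε hε ↦ ⟨∅, ?_⟩⟩
  · filter_upwards [h ε hε] with n hn _
    simpa using hn
  · filter_upwards [h ε hε] with n hn _
    exact hn

/-- The embedding of `c₀` into the pullback space. -/
noncomputable def pullbackInclusion (g : ι → Z →L[ℝ] ℝ) (C : ι → Set ℕ) :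
    C₀(ℕ, ℝ) →L[ℝ] pullbackSubmodule g C :=
  LinearMap.mkContinuous (F := pullbackSubmodule g C) (σ := RingHom.id ℝ)
    { toFun f := ⟨(0, f.toBCF), toBCF_mem_pullbackSubmodule f⟩
      map_add' f f' := Subtype.ext (Prod.ext (add_zero 0).symm rfl)
      map_smul' c f := Subtype.ext (Prod.ext (smul_zero c).symm rfl) } 1 fun f ↦ by
    rw [one_mul]
    exact max_le (by simp) le_rfl

/-- The projection of the pullback space. -/
noncomputable def pullbackProjection (g : ι → Z →L[ℝ] ℝ) (C : ι → Set ℕ) :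
    pullbackSubmodule g C →L[ℝ] Z :=
  (ContinuousLinearMap.fst ℝ Z (BoundedContinuousFunction ℕ ℝ)).comp
    (pullbackSubmodule g C).subtypeL

theorem pullbackProjection_apply (x : pullbackSubmodule g C) :
    pullbackProjection g C x = x.1.1 :=
  rfl

theorem isTwistedSum_pullback (hg : ∀ z, ∀ ε > 0, {i | ε ≤ |g i z|}.Finite)
    (hC : ∀ i j, i ≠ j → (C i ∩ C j).Finite) :
    IsTwistedSum (X := pullbackSubmodule g C) (pullbackInclusion g C) (pullbackProjection g C) where
  injective f f' h := by
    have := congrArg (fun x : pullbackSubmodule g C ↦ x.1.2) h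
    exact ZeroAtInftyContinuousMap.toBCF_injective ℕ ℝ this
  exact x := by
    refine ⟨fun hx ↦ ?_, ?_⟩
    · obtain ⟨⟨z, y⟩, hzy⟩ := x
      obtain rfl : z = 0 := hx
      have hy : Filter.Tendsto y (Filter.cocompact ℕ) (nhds 0) := by
        rw [Filter.cocompact_eq_cofinite, Nat.cofinite_eq_atTop, Metric.tendsto_nhds]
        intro ε hε
        obtain ⟨F, hF⟩ := hzy.2 (ε / 2) (half_pos hε)
        have := (Filter.eventually_all_finset F).2 fun i _ ↦ hzy.1 i (ε / 2) (half_pos hε)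
        filter_upwards [hF, this] with n h h'
        rw [dist_zero_right, Real.norm_eq_abs]
        refine lt_of_le_of_lt ?_ (half_lt_self hε)
        by_cases hn : ∀ i ∈ F, n ∉ C i
        · exact h hn
        · push Not at hn
          obtain ⟨i, hi, hni⟩ := hn
          simpa using h' i hi hni
      exact ⟨⟨y.toContinuousMap, hy⟩, Subtype.ext (Prod.ext rfl (by ext; rfl))⟩
    · rintro ⟨f, rfl⟩
      rfl
  surjective z := by
    obtain ⟨y, hy⟩ := exists_mem_pullbackSubmodule hg hC z
    exact ⟨⟨(z, y), hy⟩, rfl⟩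

/-- If `Ext(Z, c₀) = 0`, then the operator from `Z` to `ℓ∞ / c₀` defined by `g` and `C` lifts to
`ℓ∞`. -/
theorem ExtEqZero.exists_lift [CompleteSpace Z] (h : ExtEqZero Z C₀(ℕ, ℝ))
    (hg : ∀ z, ∀ ε > 0, {i | ε ≤ |g i z|}.Finite) (hC : ∀ i j, i ≠ j → (C i ∩ C j).Finite) :
    ∃ φ : ℕ → Z →L[ℝ] ℝ, ∀ z y, (z, y) ∈ pullbackSubmodule g C →
      Filter.Tendsto (fun n ↦ y n - φ n z) Filter.atTop (nhds 0) := by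
  have : CompleteSpace (pullbackSubmodule g C) :=
    (isClosed_pullbackSubmodule g C).completeSpace_coe
  have hts := isTwistedSum_pullback hg hC
  obtain ⟨r, hr⟩ := h (pullbackSubmodule g C) _ _ hts
  have hψ (n : ℕ) : ∃ φ : Z →L[ℝ] ℝ, ∀ x : pullbackSubmodule g C,
      φ (pullbackProjection g C x) = x.1.2 n - r x n := by
    let δ : BoundedContinuousFunction ℕ ℝ →L[ℝ] ℝ := BoundedContinuousFunction.evalCLM ℝ n
    let δ' : C₀(ℕ, ℝ) →L[ℝ] ℝ := LinearMap.mkContinuous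
      { toFun f := f n
        map_add' _ _ := rfl
        map_smul' _ _ := rfl } 1 fun f ↦ by
      rw [one_mul]
      exact f.toBCF.norm_coe_le_norm n
    refine exists_clm_comp_eq_sub (X := pullbackSubmodule g C) (pullbackProjection g C) hts.surjective
      (δ.comp ((ContinuousLinearMap.snd ℝ Z _).comp (pullbackSubmodule g C).subtypeL))
      (δ'.comp r) fun x hx ↦ ?_
    obtain ⟨f, rfl⟩ := (hts.exact x).1 hx
    have hrf : r (pullbackInclusion g C f) = f := DFunLike.congr_fun hr f
    change (pullbackInclusion g C f).1.2 n = r (pullbackInclusion g C f) n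
    rw [hrf]
    rfl
  choose φ hφ using hψ
  refine ⟨φ, fun z y hzy ↦ ?_⟩
  have hlim := (r ⟨(z, y), hzy⟩).zero_at_infty'
  rw [Filter.cocompact_eq_cofinite, Nat.cofinite_eq_atTop] at hlim
  refine hlim.congr fun n ↦ ?_
  have := hφ n ⟨(z, y), hzy⟩
  rw [pullbackProjection_apply] at this
  simp only [this]
  exact (sub_sub_cancel _ _).symm

theorem indicator_mem_pullbackSubmodule (hC : ∀ i j, i ≠ j → (C i ∩ C j).Finite) {i : ι} {z : Z}
    (hi : g i z = 1) (hz : ∀ j, j ≠ i → g j z = 0) :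
    ∃ y : BoundedContinuousFunction ℕ ℝ, (∀ n, y n = (C i).indicator 1 n) ∧
      (z, y) ∈ pullbackSubmodule g C := by
  refine ⟨BoundedContinuousFunction.ofNormedAddCommGroup ((C i).indicator 1)
    continuous_of_discreteTopology 1 fun n ↦ ?_, fun n ↦ rfl, fun j ε hε ↦ ?_,
    fun ε hε ↦ ⟨{i}, Filter.Eventually.of_forall fun n hn ↦ ?_⟩⟩
  · by_cases h : n ∈ C i <;> simp [h]
  · simp only [BoundedContinuousFunction.coe_ofNormedAddCommGroup]
    rcases eq_or_ne j i with rfl | hji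
    · exact Filter.Eventually.of_forall fun n hn ↦ by simp [hn, hi, hε.le]
    · rw [← Nat.cofinite_eq_atTop]
      filter_upwards [(hC j i hji).compl_mem_cofinite] with n hn hnj
      have : n ∉ C i := fun h ↦ hn ⟨hnj, h⟩
      simp [this, hz j hji, hε.le]
  · simp [hn i (Finset.mem_singleton_self i), hε.le]

end TwistedSum

/-- The branches of the dyadic tree form an almost disjoint family. -/
theorem exists_almostDisjoint : ∃ D : (ℕ → Bool) → Set ℕ,
    (∀ x, (D x).Infinite) ∧ ∀ x y, x ≠ y → (D x ∩ D y).Finite := by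
  let c (x : ℕ → Bool) (n : ℕ) : ℕ := Encodable.encode ((List.range n).map x)
  have hc {x y : ℕ → Bool} {m n : ℕ} (h : c x m = c y n) : m = n ∧ ∀ k < m, x k = y k := by
    have h' := Encodable.encode_injective h
    have hmn : m = n := by simpa using congrArg List.length h'
    subst hmn
    exact ⟨rfl, fun k hk ↦ List.map_inj_left.1 h' k (List.mem_range.2 hk)⟩
  refine ⟨fun x ↦ range (c x), fun x ↦ infinite_range_of_injective fun m n h ↦ (hc h).1,
    fun x y hxy ↦ ?_⟩
  obtain ⟨k, hk⟩ := Function.ne_iff.1 hxy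
  refine ((finite_Iic k).image (c x)).subset ?_
  rintro _ ⟨⟨m, rfl⟩, ⟨n, hn⟩⟩
  refine ⟨m, mem_Iic.2 (not_lt.1 fun hlt ↦ hk ?_), rfl⟩
  exact (hc hn.symm).2 k hlt

theorem exists_subset_forall_symmDiff_infinite {D : Set ℕ} (hD : D.Infinite) {𝒢 : Set (Set ℕ)}
    (h𝒢 : #𝒢 < 𝔠) : ∃ C ⊆ D, ∀ G ∈ 𝒢, (symmDiff C G).Infinite := by
  by_contra! h
  have hsub : 𝒫 D ⊆ (fun x : Set ℕ × Finset ℕ ↦ symmDiff x.1 x.2) '' (𝒢 ×ˢ Set.univ) := by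
    intro C hC
    obtain ⟨G, hG, hfin⟩ := h C hC
    refine ⟨(G, hfin.toFinset), ⟨hG, trivial⟩, ?_⟩
    simp only [Finite.coe_toFinset]
    rw [symmDiff_comm C G, symmDiff_symmDiff_cancel_left]
  have h1 : #(𝒫 D) = 𝔠 := by
    have := hD.to_subtype
    rw [mk_powerset, mk_eq_aleph0, two_power_aleph0]
  have h2 : #(𝒫 D) < 𝔠 := by
    refine ((mk_le_mk_of_subset hsub).trans mk_image_le).trans_lt ?_
    rw [mk_setProd]
    simp only [mk_univ]
    refine mul_lt_of_lt aleph0_le_continuum h𝒢 ?_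
    rw [mk_eq_aleph0]
    exact aleph0_lt_continuum
  exact h2.ne h1

/-- A family of sets of integers indexed by the cofinality of the continuum can be chosen to differ
from continuum many prescribed families. -/
theorem exists_diagonal {ι W : Type u} (hι : #ι = (𝔠 : Cardinal.{u}).ord.cof) (hW : #W ≤ 𝔠)
    (G : W → ι → Set ℕ) (D : ι → Set ℕ) (hD : ∀ i, (D i).Infinite) :
    ∃ C : ι → Set ℕ, (∀ i, C i ⊆ D i) ∧ ∀ w, ∃ i, (symmDiff (C i) (G w i)).Infinite := by
  obtain ⟨s, hs, hsc⟩ := Order.exists_cof_eq (𝔠 : Cardinal.{u}).ord.ToType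
  rw [Ordinal.cof_toType, ← hι] at hsc
  obtain ⟨β⟩ := Cardinal.eq.1 hsc
  obtain ⟨h⟩ : Nonempty (W ↪ (𝔠 : Cardinal.{u}).ord.ToType) := by
    rw [← Cardinal.le_def, mk_toType, card_ord]
    exact hW
  have hsmall (i : ι) : #((fun w ↦ G w i) '' {w | h w ≤ (β.symm i).1}) < 𝔠 := by
    have h1 : #{w | h w ≤ (β.symm i).1} < 𝔠 := by
      have h2 : #{w | h w ≤ (β.symm i).1} ≤ #(Iic (β.symm i).1) :=
        mk_le_of_injective (f := fun w ↦ ⟨h w.1, w.2⟩) fun w w' hw ↦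
          Subtype.ext (h.injective (congrArg Subtype.val hw))
      refine h2.trans_lt ?_
      rw [← Iio_insert]
      refine mk_insert_le.trans_lt (add_lt_of_lt aleph0_le_continuum 
        ((mk_Iio_lt _ (by simp)).trans_eq (mk_ord_toType _)) ?_)
      exact one_lt_aleph0.trans_le aleph0_le_continuum
    have h3 := mk_image_le_lift (f := fun w ↦ G w i) (s := {w | h w ≤ (β.symm i).1})
    rw [← Cardinal.lift_lt.{0, u}, lift_continuum]
    refine h3.trans_lt ?_
    rwa [Cardinal.lift_uzero]
  choose C hCD hC using fun i ↦ exists_subset_forall_symmDiff_infinite (hD i) (hsmall i)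
  refine ⟨C, hCD, fun w ↦ ?_⟩
  obtain ⟨b, hb, hwb⟩ := hs (h w)
  exact ⟨β ⟨b, hb⟩, hC _ _ ⟨w, by simpa using hwb, rfl⟩⟩

theorem exists_seq_hasSum {K : Type u} [Nonempty K] {a : K → ℝ} (ha : Summable a) :
    ∃ (x : ℕ → K) (b : ℕ → ℝ), ∀ (f : K → ℝ) (r : ℝ), HasSum (fun y ↦ a y * f y) r →
      HasSum (fun k ↦ f (x k) * b k) r := by
  have : Countable (Function.support a) := ha.countable_support
  obtain ⟨m, hm⟩ := exists_injective_nat (Function.support a)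
  refine ⟨Function.extend m Subtype.val fun _ ↦ Classical.arbitrary K,
    Function.extend m (fun y ↦ a y.1) 0, fun f r h ↦ ?_⟩
  rw [← hm.hasSum_iff]
  · refine ((hasSum_subtype_iff_of_support_subset
      (Function.support_mul_subset_left a f)).2 h).congr_fun fun y ↦ ?_
    simp [hm.extend_apply, _root_.mul_comm]
  · intro k hk
    rw [Function.extend_apply' _ (0 : ℕ → ℝ) _ hk, Pi.zero_apply, mul_zero]

theorem theorem6p1 (K : Type u) [TopologicalSpace K] [CompactSpace K] [T2Space K]
    (hscattered : IsScatteredSpace K) (hheight : scatteredHeight K < ω)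
    (hcard : (Cardinal.continuum.{u}).ord.cof ≤ #K) :
    ¬ ExtEqZero C(K, ℝ) C₀(ℕ, ℝ) := by
  intro hext
  obtain ⟨D, N, hD⟩ := exists_isDiscreteFiltration hscattered hheight
  have hreg : (Cardinal.continuum.{u}).ord.cof.IsRegular :=
    isRegular_cof (isSuccLimit_ord aleph0_le_continuum)
  obtain ⟨i, p, S, hS, hpD, hpS, hSD, hfin⟩ := hD.exists_convergent_set hscattered hreg hcard
  have : Nonempty K := ⟨p⟩
  have : Infinite S := infinite_iff.2 (hS ▸ hreg.aleph0_le)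
  choose e he1 he0 using fun s : S ↦ hD.exists_bump (hSD s.2).1 (hSD s.2).2
  let V : Set (S → ℝ) := range fun x s ↦ e s x
  have hV : #V ≤ 𝔠 := (hD.mk_range_eval_le e).trans (hS.le.trans (cof_ord_le _))
  have hW : #(ℕ → ℕ → V × ℝ) ≤ 𝔠 := by
    have h1 : #(V × ℝ) ≤ 𝔠 := by
      rw [mk_prod, mk_real, lift_continuum, Cardinal.lift_uzero]
      exact (mul_le_mul' hV le_rfl).trans continuum_mul_self.le
    have h2 {A : Type u} (hA : #A ≤ 𝔠) : #(ℕ → A) ≤ 𝔠 := by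
      rw [mk_arrow, mk_nat, lift_aleph0, Cardinal.lift_uzero]
      exact (power_le_power_right hA).trans continuum_power_aleph0.le
    exact h2 (h2 h1)
  obtain ⟨B, hBinf, hBfin⟩ := exists_almostDisjoint
  obtain ⟨τ⟩ : Nonempty (S ↪ (ℕ → Bool)) := by
    rw [← lift_mk_le', hS]
    simpa using cof_ord_le (𝔠 : Cardinal.{u})
  obtain ⟨C, hCB, hC⟩ := exists_diagonal hS hW
    (fun w s ↦ {n | 1 / 2 ≤ ∑' k, (w n k).1.1 s * (w n k).2}) (fun s ↦ B (τ s))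
    fun s ↦ hBinf _
  have hCfin (s t : S) (hst : s ≠ t) : (C s ∩ C t).Finite :=
    (hBfin _ _ (τ.injective.ne hst)).subset (inter_subset_inter (hCB s) (hCB t))
  let g (s : S) : C(K, ℝ) →L[ℝ] ℝ :=
    ContinuousMap.evalCLM ℝ (s : K) - ContinuousMap.evalCLM ℝ p
  have hg (f : C(K, ℝ)) (ε : ℝ) (hε : ε > 0) : {s | ε ≤ |g s f|}.Finite :=
    Set.Finite.of_finite_image ((hfin f ε hε).subset (by
      rintro _ ⟨s, hs, rfl⟩
      exact ⟨s.2, hs⟩)) Subtype.val_injective.injOn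
  obtain ⟨φ, hφ⟩ := hext.exists_lift hg hCfin
  have hcode (n : ℕ) : ∃ w : ℕ → V × ℝ, ∀ s, φ n (e s) = ∑' k, (w k).1.1 s * (w k).2 := by
    obtain ⟨a, ha, haf⟩ := hD.exists_hasSum (φ n)
    obtain ⟨x, b, hxb⟩ := exists_seq_hasSum ha
    exact ⟨fun k ↦ (⟨_, x k, rfl⟩, b k), fun s ↦ (hxb _ _ (haf (e s))).tsum_eq.symm⟩
  choose w hw using hcode
  obtain ⟨s, hs⟩ := hC w
  have hep : e s p = 0 := he0 s p hpD fun h ↦ hpS (h ▸ s.2)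
  obtain ⟨y, hy, hmem⟩ := indicator_mem_pullbackSubmodule (g := g) hCfin (i := s) (z := e s)
    (show e s s - e s p = 1 by rw [he1, hep, _root_.sub_zero])
    (fun t hts ↦ show e s t - e s p = 0 by
      rw [he0 s t (hSD t.2).1 (Subtype.coe_injective.ne hts), hep, _root_.sub_zero])
  have hlim := hφ _ _ hmem
  rw [Metric.tendsto_nhds] at hlim
  have hev := hlim (1 / 2) (by norm_num)
  rw [← Nat.cofinite_eq_atTop] at hev
  refine hs ((Filter.eventually_cofinite.1 hev).subset fun n hn hdist ↦ ?_)
  rw [dist_zero_right, Real.norm_eq_abs, hy, hw, abs_lt] at hdist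
  rcases hn with ⟨hn, hn'⟩ | ⟨hn', hn⟩
  · refine hn' (show (1 / 2 : ℝ) ≤ _ from ?_)
    rw [indicator_of_mem hn, Pi.one_apply] at hdist
    linarith
  · have : (1 / 2 : ℝ) ≤ ∑' k, (w n k).1.1 s * (w n k).2 := hn'
    rw [indicator_of_notMem hn] at hdist
    linarith
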